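/- Let $q$ be a prime power, let $m\ge 1$ and $r$ be integers with $r\mid q-1$ and $1\le r<q-1$, and put $t=r\,\frac{q^m-1}{q-1}$ and $n=q^m-1$. Let $\alpha$ be a primitive element of $\mathbb F_{q^m}$ (an element of multiplicative order $n$) and, for $1\le i\le t$, let $m_i(x)$ be the minimal polynomial of $\alpha^i$ over $\mathbb F_q$. The narrow-sense primitive BCH code $\mathbf C_{(q,\,q^m-1,\,t+1,\,1)}$ of designed distance $t+1$ is the cyclic code of length $n$ over $\mathbb F_q$ with generator polynomial $g(x)=\operatorname{lcm}(m_1(x),\dots,m_t(x))$, that is, the set of all words $(c_0,\dots,c_{n-1})\in\mathbb F_q^n$ for which the class of $c_0+c_1x+\dots+c_{n-1}x^{n-1}$ lies in the ideal of $\mathbb F_q[x]/(x^n-1)$ generated by $g(x)$. Then this code has minimum Hamming distance exactly $t+1$ and dimension $(q-r)^m-1$ over $\mathbb F_q$. -/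

import Mathlib

open Polynomial

noncomputable section

/-- A set of words `C` of length `n` over the alphabet `K` has minimum (Hamming) distance `d`:
`d` is the least of the distances between two distinct codewords. In particular, `C` has at least
two codewords. -/
def HasMinDist {K : Type*} [DecidableEq K] {n : ℕ} (C : Set (Fin n → K)) (d : ℕ) : Prop :=
  IsLeast {w : ℕ | ∃ x ∈ C, ∃ y ∈ C, x ≠ y ∧ hammingDist x y = w} d

/-- The polynomial `c₀ + c₁ X + ⋯ + c_{n-1} X^{n-1}` of a word `c = (c₀, …, c_{n-1})`. -/
def wordPoly (K : Type*) [Field K] (n : ℕ) : (Fin n → K) →ₗ[K] K[X] :=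
  ∑ i : Fin n, (Polynomial.monomial (i : ℕ)).comp (LinearMap.proj i)

/-- The cyclic code of length `n` over `K` generated by `g`: the words `c` whose polynomial lies,
modulo `X ^ n - 1`, in the ideal of `K[X] / (X ^ n - 1)` generated by `g`. -/
def cyclicCode (K : Type*) [Field K] (n : ℕ) (g : K[X]) : Submodule K (Fin n → K) :=
  ((Ideal.span {AdjoinRoot.mk (X ^ n - 1 : K[X]) g}).restrictScalars K).comap
    ((AdjoinRoot.mkₐ (X ^ n - 1 : K[X])).toLinearMap ∘ₗ wordPoly K n)

/-- The generator polynomial `lcm (m₁, …, m_{δ-1})` of the narrow-sense BCH code of designed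
distance `δ`, where `mᵢ` is the minimal polynomial of `α ^ i` over `K`. The least common multiple
is the normalized one, that is, the monic one when `α` is algebraic over `K`. -/
def bchGenerator (K : Type*) {F : Type*} [Field K] [Field F] [Algebra K F] (α : F) (δ : ℕ) :
    K[X] :=
  letI : DecidableEq K := Classical.decEq K
  letI : NormalizedGCDMonoid K[X] := UniqueFactorizationMonoid.toNormalizedGCDMonoid K[X]
  (Finset.Icc 1 (δ - 1)).lcm fun i => minpoly K (α ^ i)

/-- The narrow-sense BCH code of length `n` and designed distance `δ` over the finite field `K`,
formed with the primitive `n`-th root of unity `α` in an extension field of `K`. -/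
def bchCode (K : Type*) {F : Type*} [Field K] [Field F] [Algebra K F] (n : ℕ) (α : F) (δ : ℕ) :
    Submodule K (Fin n → K) :=
  cyclicCode K n (bchGenerator K α δ)

end

/-! Multiplying an exponent by q modulo q^m - 1 rotates its m base-q digits, and t is the repdigit
r⋯r. An exponent with a digit below r can be rotated into [1, t]. If all digits are at least r,
every rotation is at least t, so only t itself gives a root of the generator. The nonroots number
(q-r)^m - 1, which is the dimension (`aeval_pow_bchGenerator_eq_zero_iff`, `finrank_bchCode`).

The BCH bound gives distance at least t + 1. For equality put M = (q^m-1)/(q-1), s = q-1-r and a =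
α^M, and evaluate P = ∏_{k<s} (X^M - a^k (X-1)^M) at the powers of α. Since x^M is the norm of x,
the values lie in K. As deg P < sM = n - t, the word is in the code (`mem_bchCode_of_eval`). It
vanishes at x = w/(w-1) for each w ≠ 1 with w^M = a^k for some k < s, that is, at sM - 1 points or
more, so its weight is at most t + 1 (`exists_mem_bchCode_hammingNorm_le`). -/

/-! ### Base-q digits and their rotation. -/

/-- The lowest `m` base-`q` digits of `i` are all at least `r`. -/
def DigitsGE (q m r i : ℕ) : Prop := ∀ k < m, r ≤ i / q ^ k % q

theorem card_digitsGE (q m r : ℕ) [DecidablePred (DigitsGE q m r)] :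
    ((Finset.range (q ^ m)).filter (DigitsGE q m r)).card = (q - r) ^ m := by
  have h : (Fintype.piFinset fun _ : Fin m => Finset.univ.filter fun d : Fin q => r ≤ d).card
      = ((Finset.range (q ^ m)).filter (DigitsGE q m r)).card := by
    refine Finset.card_nbij (fun f => (finFunctionFinEquiv f : ℕ)) ?_ ?_ ?_
    · intro f hf
      simp only [Finset.mem_coe, Fintype.mem_piFinset, Finset.mem_filter, Finset.mem_univ,
        true_and, Finset.mem_range, Fin.is_lt] at hf ⊢
      intro k hk
      have := hf ⟨k, hk⟩
      rwa [← finFunctionFinEquiv.symm_apply_apply f, finFunctionFinEquiv_symm_apply_val] at this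
    · intro f _ g _ hfg
      exact finFunctionFinEquiv.injective (Fin.ext hfg)
    · intro i hi
      simp only [Finset.mem_coe, Finset.mem_filter, Finset.mem_range] at hi
      refine ⟨finFunctionFinEquiv.symm ⟨i, hi.1⟩, ?_, by simp⟩
      simp only [Finset.mem_coe, Fintype.mem_piFinset, Finset.mem_filter, Finset.mem_univ,
        true_and]
      intro k
      rw [finFunctionFinEquiv_symm_apply_val]
      exact hi.2 k k.2
  rw [← h, Fintype.card_piFinset_const]
  congr 1
  have h2 : (Finset.univ.filter fun d : Fin q => r ≤ d).card = (Finset.Ico r q).card := by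
    refine Finset.card_nbij (fun d => (d : ℕ)) ?_ (Fin.val_injective.injOn) ?_
    · intro d hd
      simpa using hd
    · intro d hd
      simp only [Finset.coe_Ico, Set.mem_Ico] at hd
      exact ⟨⟨d, hd.2⟩, by simpa using hd.1, rfl⟩
  rw [h2, Nat.card_Ico]

theorem sum_digits {q m i : ℕ} (hi : i < q ^ m) :
    ∑ k ∈ Finset.range m, i / q ^ k % q * q ^ k = i := by
  have := finFunctionFinEquiv_apply (finFunctionFinEquiv.symm ⟨i, hi⟩)
  simp only [Equiv.apply_symm_apply, finFunctionFinEquiv_symm_apply_val] at this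
  rw [Finset.sum_range]
  exact this.symm

theorem digitsGE_repdigit {q r : ℕ} (m : ℕ) (hr : r < q) :
    DigitsGE q m r (r * ∑ k ∈ Finset.range m, q ^ k) := by
  intro k hk
  have h := finFunctionFinEquiv_symm_apply_val
    (finFunctionFinEquiv fun _ : Fin m => (⟨r, hr⟩ : Fin q)) ⟨k, hk⟩
  rw [Equiv.symm_apply_apply, finFunctionFinEquiv_apply] at h
  simp only [← Finset.mul_sum, ← Finset.sum_range (fun i => q ^ i)] at h
  exact h.le

theorem DigitsGE.repdigit_le {q m r i : ℕ} (h : DigitsGE q m r i) (hi : i < q ^ m) :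
    r * ∑ k ∈ Finset.range m, q ^ k ≤ i := by
  rw [← sum_digits hi, Finset.mul_sum]
  exact Finset.sum_le_sum fun k hk => Nat.mul_le_mul_right _ (h k (Finset.mem_range.1 hk))

/-- Rotating a digit d < r to the top position gives a number below (d+1)q^(m-1) ≤ r q^(m-1). -/
theorem exists_modEq_of_not_digitsGE {q m r i : ℕ} (h : ¬ DigitsGE q m r i) (hi0 : 0 < i)
    (hi : i < q ^ m) :
    ∃ e j, 1 ≤ j ∧ j ≤ r * ∑ k ∈ Finset.range m, q ^ k ∧ i * q ^ e ≡ j [MOD q ^ m - 1] := by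
  simp only [DigitsGE, not_forall, not_le] at h
  obtain ⟨k, hk, hd⟩ := h
  obtain ⟨e, rfl⟩ : ∃ e, m = k + 1 + e := Nat.exists_eq_add_of_lt hk |>.imp fun e he => by omega
  have hq : 0 < q := by
    rcases Nat.eq_zero_or_pos q with rfl | h
    · simp at hi
    · exact h
  set A := i / q ^ (k + 1)
  set d := i / q ^ k % q
  set B := i % q ^ k
  have hiA : i = A * q ^ (k + 1) + d * q ^ k + B := by
    have h1 := Nat.div_add_mod i (q ^ k)
    have h2 := Nat.div_add_mod (i / q ^ k) q
    rw [Nat.div_div_eq_div_mul, ← pow_succ] at h2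
    calc i = q ^ k * (q * A + d) + B := by rw [h2, h1]
      _ = _ := by ring
  have hB : B < q ^ k := Nat.mod_lt _ (by positivity)
  have hA : A < q ^ e := by
    apply Nat.div_lt_of_lt_mul
    rwa [← pow_add]
  have hpow : 1 ≤ q ^ (k + 1 + e) := Nat.one_le_pow _ _ hq
  clear_value A d B
  refine ⟨e, d * q ^ (k + e) + B * q ^ e + A, ?_, ?_, ?_⟩
  · by_contra h0
    have hA0 : A = 0 := by omega
    have h1 : d * q ^ (k + e) = 0 := by omega
    have h2 : B * q ^ e = 0 := by omega
    have hd0 : d = 0 := by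
      rcases mul_eq_zero.1 h1 with h | h
      · exact h
      · exact absurd h (by positivity)
    have hB0 : B = 0 := by
      rcases mul_eq_zero.1 h2 with h | h
      · exact h
      · exact absurd h (by positivity)
    rw [hA0, hd0, hB0] at hiA
    omega
  · have h1 : (B + 1) * q ^ e ≤ q ^ k * q ^ e := Nat.mul_le_mul_right _ hB
    have h2 : (d + 1) * q ^ (k + e) ≤ r * q ^ (k + e) := Nat.mul_le_mul_right _ hd
    have h3 : q ^ (k + e) ≤ ∑ x ∈ Finset.range (k + 1 + e), q ^ x :=
      Finset.single_le_sum (f := fun x => q ^ x) (fun _ _ => Nat.zero_le _)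
        (Finset.mem_range.2 (by omega))
    have h4 := Nat.mul_le_mul_left r h3
    rw [← pow_add, add_mul, one_mul] at h1
    rw [add_mul, one_mul] at h2
    omega
  · have : i * q ^ e = d * q ^ (k + e) + B * q ^ e + A + (q ^ (k + 1 + e) - 1) * A := by
      zify [hpow]
      rw [hiA]
      push_cast
      ring
    rw [this]
    simp [Nat.ModEq]

/-- The top digit a moves to the bottom, so the multiset of digits is unchanged. -/
theorem DigitsGE.exists_modEq_mul {q m r i : ℕ} (h : DigitsGE q m r i)
    (hi : i < q ^ m) :
    ∃ j, DigitsGE q m r j ∧ j < q ^ m ∧ i * q ≡ j [MOD q ^ m - 1] := by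
  rcases m with _ | m
  · exact ⟨0, fun k hk => by omega, by simp, by
      obtain rfl : i = 0 := by simpa using hi
      simp [Nat.ModEq]⟩
  have hq : 0 < q := by
    rcases Nat.eq_zero_or_pos q with rfl | h
    · simp at hi
    · exact h
  set a := i / q ^ m
  set b := i % q ^ m
  have hb : b < q ^ m := Nat.mod_lt _ (by positivity)
  have hiab : q ^ m * a + b = i := Nat.div_add_mod i (q ^ m)
  have haq : a < q := Nat.div_lt_of_lt_mul (by rwa [← pow_succ])
  have hpow : 1 ≤ q ^ (m + 1) := Nat.one_le_pow _ _ hq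
  refine ⟨q * b + a, ?_, ?_, ?_⟩
  · intro k hk
    rcases k with _ | k
    · have := h m (by omega)
      rw [Nat.mod_eq_of_lt haq] at this
      simpa [Nat.mod_eq_of_lt haq] using this
    · have := h k (by omega)
      rw [pow_succ', ← Nat.div_div_eq_div_mul, Nat.mul_add_div hq, Nat.div_eq_of_lt haq, add_zero]
      convert this using 1
      have hkm : m = k + 1 + (m - (k + 1)) := by omega
      have : i = b + q ^ k * (q * (q ^ (m - (k + 1)) * a)) := by
        rw [← hiab]
        conv_lhs => rw [hkm]
        ring
      rw [this, Nat.add_mul_div_left _ _ (by positivity), Nat.add_mul_mod_self_left]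
  · calc q * b + a < q * b + q := by omega
      _ = q * (b + 1) := by ring
      _ ≤ q * q ^ m := Nat.mul_le_mul_left _ hb
      _ = _ := (pow_succ' q m).symm
  · have : i * q = q * b + a + (q ^ (m + 1) - 1) * a := by
      zify [hpow]
      rw [← hiab]
      push_cast
      ring
    rw [this]
    simp [Nat.ModEq]

/-! ### Cyclic codes and the BCH bound. -/

section CyclicCodes

variable {K F : Type*} [Field K] [Field F] [Algebra K F]

theorem wordPoly_apply (n : ℕ) (c : Fin n → K) :
    wordPoly K n c = ∑ i : Fin n, monomial (i : ℕ) (c i) := by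
  simp [wordPoly]

theorem aeval_wordPoly (n : ℕ) (c : Fin n → K) (x : F) :
    aeval x (wordPoly K n c) = ∑ i : Fin n, algebraMap K F (c i) * x ^ (i : ℕ) := by
  simp [wordPoly_apply, aeval_monomial]

theorem wordPoly_coeff {n : ℕ} {p : K[X]} (hp : p.degree < n) :
    wordPoly K n (fun i => p.coeff i) = p := by
  rw [wordPoly_apply, ← Finset.sum_range (fun i => monomial i (p.coeff i))]
  by_cases h0 : p = 0
  · simp [h0]
  · exact (p.as_sum_range' n ((natDegree_lt_iff_degree_lt h0).2 hp)).symm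

theorem mem_cyclicCode {n : ℕ} {g : K[X]} (hg : g ∣ X ^ n - 1) (c : Fin n → K) :
    c ∈ cyclicCode K n g ↔ g ∣ wordPoly K n c := by
  have : c ∈ cyclicCode K n g ↔ AdjoinRoot.mk (X ^ n - 1 : K[X]) (wordPoly K n c) ∈
      Ideal.span {AdjoinRoot.mk (X ^ n - 1 : K[X]) g} := Iff.rfl
  rw [this, Ideal.mem_span_singleton]
  constructor
  · rintro ⟨h, hh⟩
    obtain ⟨h, rfl⟩ := AdjoinRoot.mk_surjective h
    rw [← map_mul, AdjoinRoot.mk_eq_mk] at hh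
    exact (dvd_sub_left (dvd_mul_right g h)).1 (hg.trans hh)
  · exact map_dvd _

/-- The code is the kernel of the surjection K^n → K[X]/(g). -/
theorem finrank_cyclicCode {n : ℕ} (hn : 0 < n) {g : K[X]} (hg : g ∣ X ^ n - 1) :
    Module.finrank K (cyclicCode K n g) = n - g.natDegree := by
  have hne : (X ^ n - 1 : K[X]) ≠ 0 := X_pow_sub_C_ne_zero hn 1
  have hg0 : g ≠ 0 := ne_zero_of_dvd_ne_zero hne hg
  let φ : (Fin n → K) →ₗ[K] AdjoinRoot g := (AdjoinRoot.mkₐ g).toLinearMap ∘ₗ wordPoly K n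
  have hφ (c) : φ c = AdjoinRoot.mk g (wordPoly K n c) := rfl
  have hker : LinearMap.ker φ = cyclicCode K n g := by
    ext c
    rw [LinearMap.mem_ker, hφ, AdjoinRoot.mk_eq_zero, mem_cyclicCode hg]
  have hrange : LinearMap.range φ = ⊤ := by
    rw [LinearMap.range_eq_top]
    intro y
    obtain ⟨p, rfl⟩ := AdjoinRoot.mk_surjective y
    refine ⟨fun i => (p % g).coeff i, ?_⟩
    rw [hφ, wordPoly_coeff, AdjoinRoot.mk_eq_mk, EuclideanDomain.mod_eq_sub_mul_div]
    · simp
    · refine (degree_mod_lt p hg0).trans_le ((degree_le_of_dvd hg hne).trans ?_)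
      rw [← C_1, degree_X_pow_sub_C hn]
  have h := LinearMap.finrank_range_add_finrank_ker φ
  rw [hrange, hker, finrank_top, (AdjoinRoot.powerBasis hg0).finrank, AdjoinRoot.powerBasis_dim,
    Module.finrank_fin_fun] at h
  omega

/-- All that is needed of the lcm; its normalization plays no role. -/
theorem bchGenerator_dvd_iff (α : F) (δ : ℕ) (p : K[X]) :
    bchGenerator K α δ ∣ p ↔ ∀ i ∈ Finset.Icc 1 (δ - 1), aeval (α ^ i) p = 0 := by
  let _ : DecidableEq K := Classical.decEq K
  let _ : NormalizedGCDMonoid K[X] := UniqueFactorizationMonoid.toNormalizedGCDMonoid K[X]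
  have h : bchGenerator K α δ ∣ p ↔ ∀ i ∈ Finset.Icc 1 (δ - 1), minpoly K (α ^ i) ∣ p :=
    Finset.lcm_dvd_iff
  simp_rw [h, minpoly.dvd_iff]

theorem bchGenerator_dvd_X_pow_sub_one {α : F} {n : ℕ} (hα : α ^ n = 1) (δ : ℕ) :
    bchGenerator K α δ ∣ X ^ n - 1 := by
  rw [bchGenerator_dvd_iff]
  intro i _
  simp [pow_right_comm α i n, hα]

theorem aeval_bchGenerator_eq_zero_iff (α : F) (δ : ℕ) (x : F) :
    aeval x (bchGenerator K α δ) = 0 ↔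
      ∃ i ∈ Finset.Icc 1 (δ - 1), aeval x (minpoly K (α ^ i)) = 0 := by
  constructor
  · intro h
    have hdvd : bchGenerator K α δ ∣ ∏ i ∈ Finset.Icc 1 (δ - 1), minpoly K (α ^ i) := by
      rw [bchGenerator_dvd_iff]
      exact fun i hi => (minpoly.dvd_iff).1 (Finset.dvd_prod_of_mem _ hi)
    obtain ⟨k, hk⟩ := hdvd
    have := congrArg (aeval x) hk
    rw [map_mul, h, zero_mul, map_prod, Finset.prod_eq_zero_iff] at this
    exact this
  · rintro ⟨i, hi, h⟩
    have hdvd : minpoly K (α ^ i) ∣ bchGenerator K α δ :=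
      minpoly.dvd K _ ((bchGenerator_dvd_iff α δ _).1 dvd_rfl i hi)
    obtain ⟨k, hk⟩ := hdvd
    rw [hk, map_mul, h, zero_mul]

theorem mem_bchCode {α : F} {n : ℕ} (hα : α ^ n = 1) (δ : ℕ) (c : Fin n → K) :
    c ∈ bchCode K n α δ ↔ ∀ i ∈ Finset.Icc 1 (δ - 1),
      ∑ j : Fin n, algebraMap K F (c j) * (α ^ (j : ℕ)) ^ i = 0 := by
  rw [bchCode, mem_cyclicCode (bchGenerator_dvd_X_pow_sub_one hα δ), bchGenerator_dvd_iff]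
  simp_rw [aeval_wordPoly, pow_right_comm]

/-- The BCH bound. -/
theorem le_hammingNorm_of_mem_bchCode [DecidableEq K] {α : F} {n : ℕ} (hα : IsPrimitiveRoot α n)
    {t : ℕ} {c : Fin n → K} (hc : c ∈ bchCode K n α (t + 1)) (hc0 : c ≠ 0) :
    t + 1 ≤ hammingNorm c := by
  classical
  by_contra! hlt
  obtain ⟨j₀, hj₀⟩ := Function.ne_iff.1 hc0
  have hn : n ≠ 0 := fun h => by subst h; exact j₀.elim0
  have hα0 : α ≠ 0 := hα.ne_zero hn
  set S := (Finset.univ.filter fun j => c j ≠ 0).erase j₀ with hS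
  have hcard : S.card + 1 = hammingNorm c :=
    Finset.card_erase_add_one (by simpa using hj₀)
  -- This vanishes on the support of c except at j₀. The factor X removes the constant term, since
  -- the checks cover only the exponents 1, …, t.
  let p : F[X] := X * ∏ j ∈ S, (X - C (α ^ (j : ℕ)))
  have hdeg : p.natDegree < t + 1 := by
    have : p.natDegree ≤ 1 + S.card := by
      refine natDegree_mul_le.trans ?_
      rw [natDegree_X, natDegree_prod_of_monic _ _ fun j _ => monic_X_sub_C _]
      simp only [natDegree_X_sub_C, Finset.sum_const, smul_eq_mul, mul_one, le_refl]
    omega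
  rw [mem_bchCode hα.pow_eq_one] at hc
  have hsum : ∑ j : Fin n, algebraMap K F (c j) * p.eval (α ^ (j : ℕ)) = 0 := by
    simp_rw [eval_eq_sum_range' hdeg, Finset.mul_sum]
    rw [Finset.sum_comm]
    refine Finset.sum_eq_zero fun i hi => ?_
    rcases Nat.eq_zero_or_pos i with rfl | hi0
    · simp [p]
    · have := hc i (by simp at hi ⊢; omega)
      simp_rw [mul_left_comm _ (p.coeff i), ← Finset.mul_sum, this, mul_zero]
  rw [Finset.sum_eq_single j₀] at hsum
  · simp only [mul_eq_zero, map_eq_zero, p, eval_mul, eval_X, eval_prod, Finset.prod_eq_zero_iff,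
      eval_sub, eval_C, sub_eq_zero, pow_eq_zero_iff', hα0, false_and, false_or] at hsum
    rcases hsum with h | ⟨j, hj, h⟩
    · exact hj₀ h
    · have := Fin.ext (hα.pow_inj j₀.2 j.2 h)
      simp [S, this] at hj
  · intro j _ hj
    by_cases h : c j = 0
    · simp [h]
    · have hjS : j ∈ S := by simp [S, hj, h]
      simp [p, eval_prod, Finset.prod_eq_zero hjS]
  · simp

end CyclicCodes

/-! ### Roots of the generator and the dimension. -/

section PrimitiveBCH

variable {K F : Type*} [Field K] [Field F] [Finite F] [Algebra K F]

/-- The Galois group of F over K consists of powers of Frobenius. -/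
theorem isConjRoot_iff_exists_pow {x y : F} :
    IsConjRoot K x y ↔ ∃ k : ℕ, y = x ^ Nat.card K ^ k := by
  have := Finite.of_injective _ (algebraMap K F).injective
  have := Fintype.ofFinite K
  rw [IsConjRoot.comm, isConjRoot_iff_exists_algEquiv, Nat.card_eq_fintype_card]
  have key (k : ℕ) : (FiniteField.frobeniusAlgEquivOfAlgebraic K F ^ k) x
      = x ^ Fintype.card K ^ k := by
    rw [AlgEquiv.coe_pow, FiniteField.coe_frobeniusAlgEquivOfAlgebraic_iterate]
  constructor
  · rintro ⟨σ, rfl⟩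
    obtain ⟨k, rfl⟩ := (FiniteField.bijective_frobeniusAlgEquivOfAlgebraic_pow K F).2 σ
    exact ⟨k, key k⟩
  · rintro ⟨k, rfl⟩
    exact ⟨_, key k⟩

theorem natCast_card_sub_one_ne_zero : ((Nat.card F - 1 : ℕ) : K) ≠ 0 := by
  have := Fintype.ofFinite F
  intro h
  have h2 := congrArg (algebraMap K F) h
  rw [map_natCast, map_zero, Nat.cast_sub Nat.card_pos, Nat.card_eq_fintype_card,
    FiniteField.cast_card_eq_zero] at h2
  simp at h2

theorem card_rootSet_of_dvd_X_pow_card_sub_one {α : F}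
    (hα : IsPrimitiveRoot α (Nat.card F - 1)) {g : K[X]} (hg : g ∣ X ^ (Nat.card F - 1) - 1) :
    Fintype.card (g.rootSet F) = g.natDegree := by
  have hsep : (X ^ (Nat.card F - 1) - 1 : K[X]).Separable :=
    X_pow_sub_one_separable_iff.2 natCast_card_sub_one_ne_zero
  have hsplit : (map (algebraMap K F) (X ^ (Nat.card F - 1) - 1)).Splits := by
    simpa using X_pow_sub_one_splits hα
  refine card_rootSet_eq_natDegree (hsep.of_dvd hg) (hsplit.of_dvd ?_ (Polynomial.map_dvd _ hg))
  exact (Polynomial.map_ne_zero_iff (algebraMap K F).injective).2 hsep.ne_zero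

variable {q m r : ℕ}

/-- Among the exponents in `[1, q ^ m - 1]`, exactly those with a base-`q` digit less than `r`, and the
repdigit `r ⋯ r`, give roots of the generator polynomial. -/
theorem aeval_pow_bchGenerator_eq_zero_iff (hK : Nat.card K = q) (hF : Nat.card F = q ^ m)
    (hr0 : 0 < r) (hrq : r < q) {α : F} (hα : IsPrimitiveRoot α (q ^ m - 1)) {i : ℕ}
    (hi0 : 0 < i) (hi : i < q ^ m) :
    aeval (α ^ i) (bchGenerator K α (r * ∑ k ∈ Finset.range m, q ^ k + 1)) = 0 ↔
      ¬ (DigitsGE q m r i ∧ i ≠ r * ∑ k ∈ Finset.range m, q ^ k) := by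
  set t := r * ∑ k ∈ Finset.range m, q ^ k with ht
  have hint (x : F) : IsIntegral K x := Algebra.IsIntegral.isIntegral x
  have hmod {a b : ℕ} (h : a ≡ b [MOD q ^ m - 1]) : α ^ a = α ^ b := by
    rw [pow_eq_pow_mod a hα.pow_eq_one, show a % (q ^ m - 1) = b % (q ^ m - 1) from h,
      ← pow_eq_pow_mod b hα.pow_eq_one]
  have hinj {a b : ℕ} (ha : 0 < a) (ha' : a < q ^ m) (hb : 0 < b) (hb' : b < q ^ m)
      (h : α ^ a = α ^ b) : a = b := by
    have h1 : a - 1 = b - 1 := by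
      refine hα.pow_inj (by omega) (by omega)
        (mul_right_cancel₀ (hα.ne_zero (by omega)) ?_)
      rw [← pow_succ, ← pow_succ, Nat.sub_add_cancel ha, Nat.sub_add_cancel hb, h]
    omega
  have hpos {a : ℕ} (ha : DigitsGE q m r a) : 0 < a := by
    rcases m with _ | m
    · simp at hi
      omega
    · have := ha 0 (by omega)
      rcases Nat.eq_zero_or_pos a with rfl | h
      · simp at this
        omega
      · exact h
  rw [aeval_bchGenerator_eq_zero_iff, Nat.add_sub_cancel]
  simp_rw [← isConjRoot_iff_aeval_eq_zero (hint _)]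
  constructor
  · rintro ⟨j, hj, hconj⟩ ⟨hd, hne⟩
    rw [Finset.mem_Icc] at hj
    have htlt : t < q ^ m := (hd.repdigit_le hi).trans_lt hi
    obtain ⟨k, hk⟩ := isConjRoot_iff_exists_pow.1 hconj.symm
    -- Every conjugate of α^i has an exponent whose digits are all at least r; being at most t as
    -- well, the exponent j must equal t.
    have hex : ∀ k : ℕ, ∃ a, DigitsGE q m r a ∧ a < q ^ m ∧ α ^ a = (α ^ i) ^ q ^ k := by
      intro k
      induction k with
      | zero => exact ⟨i, hd, hi, by simp⟩
      | succ k ih =>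
        obtain ⟨a, ha, ha', hak⟩ := ih
        obtain ⟨b, hb, hb', hab⟩ := ha.exists_modEq_mul ha'
        exact ⟨b, hb, hb', by rw [← hmod hab, pow_mul, hak, ← pow_mul, ← pow_succ]⟩
    obtain ⟨a, ha, ha', hak⟩ := hex k
    obtain rfl : a = j := hinj (hpos ha) ha' hj.1 (hj.2.trans_lt htlt) (by rw [hak, hk, hK])
    obtain rfl : a = t := le_antisymm hj.2 (ha.repdigit_le ha')
    apply hne
    -- Since t(q-1) = r(q^m-1), α^t is its own only conjugate, which forces i = t.
    have hfix : (α ^ t) ^ q = α ^ t := by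
      rw [← pow_mul]
      apply hmod
      have hgeom := Nat.geomSum_eq (show 2 ≤ q by omega) m
      have hq1 : q - 1 ∣ q ^ m - 1 := by simpa using Nat.sub_dvd_pow_sub_pow q 1 m
      have hM : (∑ k ∈ Finset.range m, q ^ k) * (q - 1) = q ^ m - 1 := by
        rw [hgeom, Nat.div_mul_cancel hq1]
      have : t * q = t + (q ^ m - 1) * r := by
        rw [← hM, ht]
        obtain ⟨p, rfl⟩ : ∃ p, q = p + 1 := ⟨q - 1, by omega⟩
        simp only [Nat.add_sub_cancel]
        ring
      rw [this]
      simp [Nat.ModEq]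
    have hfix' : ∀ k : ℕ, (α ^ t) ^ q ^ k = α ^ t := by
      intro k
      induction k with
      | zero => simp
      | succ k ih => rw [pow_succ, pow_mul, ih, hfix]
    obtain ⟨l, hl⟩ := isConjRoot_iff_exists_pow.1 hconj
    rw [hK, hfix'] at hl
    exact hinj hi0 hi (hpos ha) ha' hl
  · intro h
    by_cases hd : DigitsGE q m r i
    · obtain rfl : i = t := by
        by_contra hne
        exact h ⟨hd, hne⟩
      exact ⟨t, Finset.mem_Icc.2 ⟨hi0, le_rfl⟩, IsConjRoot.refl⟩
    · obtain ⟨e, j, hj, hjt, he⟩ := exists_modEq_of_not_digitsGE hd hi0 hi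
      refine ⟨j, Finset.mem_Icc.2 ⟨hj, hjt⟩, IsConjRoot.symm ?_⟩
      rw [isConjRoot_iff_exists_pow, hK]
      exact ⟨e, by rw [← pow_mul, hmod he]⟩

theorem finrank_bchCode (hK : Nat.card K = q) (hF : Nat.card F = q ^ m) (hm : 0 < m)
    (hr0 : 0 < r) (hrq : r < q) {α : F} (hα : IsPrimitiveRoot α (q ^ m - 1)) :
    Module.finrank K (bchCode K (q ^ m - 1) α (r * ∑ k ∈ Finset.range m, q ^ k + 1)) =
      (q - r) ^ m - 1 := by
  classical
  set t := r * ∑ k ∈ Finset.range m, q ^ k with ht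
  set g := bchGenerator K α (t + 1) with hg
  have hqm : q ≤ q ^ m := Nat.le_self_pow hm.ne' q
  have hdvd : g ∣ X ^ (q ^ m - 1) - 1 := bchGenerator_dvd_X_pow_sub_one hα.pow_eq_one _
  have hne : (X ^ (q ^ m - 1) - 1 : K[X]) ≠ 0 := X_pow_sub_C_ne_zero (by omega) 1
  have hg0 : g ≠ 0 := ne_zero_of_dvd_ne_zero hne hdvd
  have hα0 : α ≠ 0 := hα.ne_zero (by omega)
  rw [bchCode, finrank_cyclicCode (by omega) hdvd]
  set P : Finset ℕ := (Finset.range (q ^ m)).filter (DigitsGE q m r) with hP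
  have hPcard : P.card = (q - r) ^ m := card_digitsGE q m r
  have h0P : 0 ∉ P := by
    intro h
    have := (Finset.mem_filter.1 h).2 0 hm
    simp at this
    omega
  have hlt : t < q ^ m := by
    have hP1 : 1 ≤ P.card := hPcard ▸ Nat.one_le_pow _ _ (by omega)
    obtain ⟨a, ha⟩ := Finset.card_pos.1 hP1
    rw [hP, Finset.mem_filter, Finset.mem_range] at ha
    exact (ha.2.repdigit_le ha.1).trans_lt ha.1
  have htP : t ∈ P := Finset.mem_filter.2 ⟨Finset.mem_range.2 hlt, digitsGE_repdigit m hrq⟩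
  -- Exponents run over [1, q^m-1] rather than from 0: the digit criterion applies to the
  -- representative q^m-1 of the exponent of 1, and would fail for 0.
  set Z : Finset ℕ := Finset.Icc 1 (q ^ m - 1) \ P.erase t with hZ
  have hsub : P.erase t ⊆ Finset.Icc 1 (q ^ m - 1) := by
    intro a ha
    have haP := Finset.mem_of_mem_erase ha
    have : a ≠ 0 := fun h => h0P (h ▸ haP)
    rw [hP, Finset.mem_filter, Finset.mem_range] at haP
    rw [Finset.mem_Icc]
    omega
  have hZcard : Z.card = q ^ m - 1 - ((q - r) ^ m - 1) := by
    rw [hZ, Finset.card_sdiff_of_subset hsub, Finset.card_erase_of_mem htP, hPcard, Nat.card_Icc,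
      Nat.add_sub_cancel]
  have hle : (q - r) ^ m - 1 ≤ q ^ m - 1 :=
    Nat.sub_le_sub_right (Nat.pow_le_pow_left (Nat.sub_le q r) m) 1
  have hroot (i : ℕ) (hi : i ∈ Finset.Icc 1 (q ^ m - 1)) : aeval (α ^ i) g = 0 ↔ i ∈ Z := by
    rw [Finset.mem_Icc] at hi
    rw [hg, aeval_pow_bchGenerator_eq_zero_iff hK hF hr0 hrq hα hi.1 (by omega), hZ,
      Finset.mem_sdiff, Finset.mem_erase, hP, Finset.mem_filter, Finset.mem_range, Finset.mem_Icc]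
    have : i < q ^ m := by omega
    tauto
  have hcard : Z.card = g.natDegree := by
    rw [← card_rootSet_of_dvd_X_pow_card_sub_one (F := F) (by rwa [hF]) (by rwa [hF]),
      ← Set.toFinset_card]
    refine Finset.card_nbij (fun i => α ^ i) ?_ ?_ ?_
    · intro i hi
      have hi' := (Finset.mem_sdiff.1 hi).1
      simpa [mem_rootSet, hg0] using (hroot i hi').2 hi
    · intro a ha b hb hab
      have ha' := Finset.mem_Icc.1 (Finset.mem_sdiff.1 ha).1
      have hb' := Finset.mem_Icc.1 (Finset.mem_sdiff.1 hb).1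
      have h1 : a - 1 = b - 1 := by
        refine hα.pow_inj (by omega) (by omega) (mul_right_cancel₀ hα0 ?_)
        rw [← pow_succ, ← pow_succ, Nat.sub_add_cancel ha'.1, Nat.sub_add_cancel hb'.1]
        exact hab
      omega
    · intro x hx
      have hx0 : aeval x g = 0 := by simpa [mem_rootSet, hg0] using hx
      have hx1 : x ^ (q ^ m - 1) = 1 := by
        obtain ⟨k, hk⟩ := hdvd
        have := congrArg (aeval x) hk
        rw [map_mul, hx0, zero_mul] at this
        simpa [sub_eq_zero] using this
      have : NeZero (q ^ m - 1) := ⟨by omega⟩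
      obtain ⟨i, hi, rfl⟩ := hα.eq_pow_of_pow_eq_one hx1
      rcases Nat.eq_zero_or_pos i with rfl | hi0
      · have hmem : q ^ m - 1 ∈ Finset.Icc 1 (q ^ m - 1) := Finset.mem_Icc.2 (by omega)
        have he : α ^ (q ^ m - 1) = α ^ 0 := by rw [hα.pow_eq_one, pow_zero]
        exact ⟨q ^ m - 1, (hroot _ hmem).1 (he ▸ hx0), he⟩
      · exact ⟨i, (hroot i (Finset.mem_Icc.2 (by omega))).1 hx0, rfl⟩
  omega

/-! ### A codeword of weight at most t + 1. -/

omit [Finite F] in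
theorem sum_pow_pow_eq_zero {α : F} {n : ℕ} (hα : IsPrimitiveRoot α n) {e : ℕ} (he0 : e ≠ 0)
    (he : e < n) : ∑ j : Fin n, (α ^ (j : ℕ)) ^ e = 0 := by
  have h := geom_sum_mul (α ^ e) n
  rw [pow_right_comm, hα.pow_eq_one, one_pow, sub_self, mul_eq_zero, sub_eq_zero] at h
  simp_rw [pow_right_comm α _ e]
  rw [← Finset.sum_range (fun j => (α ^ e) ^ j)]
  exact h.resolve_right (hα.pow_ne_one_of_pos_of_lt he0 he)

omit [Finite F] in
/-- Evaluating a polynomial of low degree with values in `K` at the powers of `α` gives a codeword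
of the BCH code. -/
theorem mem_bchCode_of_eval {α : F} {n : ℕ} (hα : IsPrimitiveRoot α n) {t : ℕ} {P : F[X]}
    (hP : P.natDegree + t < n) {c : Fin n → K}
    (hc : ∀ j, algebraMap K F (c j) = P.eval (α ^ (j : ℕ))) : c ∈ bchCode K n α (t + 1) := by
  rw [mem_bchCode hα.pow_eq_one]
  intro i hi
  simp only [Nat.add_sub_cancel, Finset.mem_Icc] at hi
  simp_rw [hc, eval_eq_sum_range, Finset.sum_mul]
  rw [Finset.sum_comm]
  refine Finset.sum_eq_zero fun e he => ?_
  rw [Finset.mem_range] at he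
  simp_rw [mul_assoc, ← pow_add, ← Finset.mul_sum]
  rw [sum_pow_pow_eq_zero hα (by omega) (by omega), mul_zero]

-- Strictness comes from the factor k = 0, where the leading terms of X^M and (X-1)^M cancel.
omit [Finite F] in
theorem natDegree_prod_X_pow_sub_lt (a : F) {M s : ℕ} (hM : 0 < M) (hs : 0 < s) :
    (∏ k ∈ Finset.range s, (X ^ M - C (a ^ k) * (X - C 1) ^ M)).natDegree < s * M := by
  obtain ⟨s, rfl⟩ : ∃ k, s = k + 1 := ⟨s - 1, by omega⟩
  rw [Finset.prod_range_succ']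
  have h0 : (X ^ M - C (a ^ 0) * (X - C 1) ^ M : F[X]).natDegree < M := by
    rw [pow_zero, C_1, one_mul, ← C_1]
    have hmon : ((X - C 1) ^ M : F[X]).Monic := (monic_X_sub_C 1).pow M
    have hdeg : ((X - C 1) ^ M : F[X]).natDegree = M := by
      rw [(monic_X_sub_C (1 : F)).natDegree_pow, natDegree_X_sub_C, mul_one]
    have hlt : (X ^ M - (X - C 1) ^ M : F[X]).degree < (X ^ M : F[X]).degree := by
      refine degree_sub_lt_left ?_ (pow_ne_zero _ X_ne_zero) ?_
      · rw [degree_X_pow, degree_eq_natDegree hmon.ne_zero, hdeg]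
      · rw [hmon.leadingCoeff, leadingCoeff_X_pow]
    rw [degree_X_pow] at hlt
    by_cases hz : (X ^ M - (X - C 1) ^ M : F[X]) = 0
    · rwa [hz, natDegree_zero]
    · exact (natDegree_lt_iff_degree_lt hz).2 hlt
  have h1 : (∏ k ∈ Finset.range s,
      (X ^ M - C (a ^ (k + 1)) * (X - C 1) ^ M) : F[X]).natDegree ≤ s * M := by
    refine (natDegree_prod_le _ _).trans
      ((Finset.sum_le_card_nsmul _ _ M fun k _ => ?_).trans (by simp))
    compute_degree
  calc _ ≤ _ := natDegree_mul_le
    _ < s * M + M := by omega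
    _ = _ := by ring

theorem exists_mem_bchCode_hammingNorm_le [DecidableEq K] (hK : Nat.card K = q)
    (hF : Nat.card F = q ^ m) (hm : 0 < m) (hrq : r < q - 1) {α : F}
    (hα : IsPrimitiveRoot α (q ^ m - 1)) :
    ∃ c ∈ bchCode K (q ^ m - 1) α (r * ∑ k ∈ Finset.range m, q ^ k + 1),
      c ≠ 0 ∧ hammingNorm c ≤ r * ∑ k ∈ Finset.range m, q ^ k + 1 := by
  classical
  have hgeom := Nat.geomSum_eq (show 2 ≤ q by omega) m
  have hq1 : q - 1 ∣ q ^ m - 1 := by simpa using Nat.sub_dvd_pow_sub_pow q 1 m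
  have hn : (q - 1) * ((q ^ m - 1) / (q - 1)) = q ^ m - 1 := Nat.mul_div_cancel' hq1
  rw [hgeom]
  set M := (q ^ m - 1) / (q - 1) with hM
  set n := q ^ m - 1 with hndef
  have hqm : q ≤ q ^ m := Nat.le_self_pow hm.ne' q
  have hn0 : 0 < n := by omega
  have hM0 : 0 < M := Nat.pos_of_ne_zero fun h => by rw [h, mul_zero] at hn; omega
  obtain ⟨s, hs⟩ : ∃ s, r + s = q - 1 := ⟨q - 1 - r, by omega⟩
  have hs0 : 0 < s := by omega
  have hsplit : r * M + s * M = n := by rw [← add_mul, hs, hn]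
  have hα0 : α ≠ 0 := hα.ne_zero hn0.ne'
  have hnorm (x : F) : algebraMap K F (Algebra.norm K x) = x ^ M := by
    rw [FiniteField.algebraMap_norm_eq_pow, hF, hK]
  let P : F[X] := ∏ k ∈ Finset.range s, (X ^ M - C ((α ^ M) ^ k) * (X - C 1) ^ M)
  let c : Fin n → K := fun j => ∏ k ∈ Finset.range s, (Algebra.norm K (α ^ (j : ℕ)) -
    Algebra.norm K α ^ k * Algebra.norm K (α ^ (j : ℕ) - 1))
  have hc (j : Fin n) : algebraMap K F (c j) = P.eval (α ^ (j : ℕ)) := by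
    simp only [c, P, map_prod, map_sub, map_mul, map_pow, hnorm, eval_prod, eval_sub, eval_mul,
      eval_pow, eval_X, eval_C]
    simp_rw [pow_right_comm α _ M]
  have hdeg : P.natDegree < s * M := natDegree_prod_X_pow_sub_lt (α ^ M) hM0 hs0
  refine ⟨c, mem_bchCode_of_eval hα (by omega) hc, ?_, ?_⟩
  -- At x = 1 each factor of P equals 1.
  · intro h0
    have h := hc ⟨0, hn0⟩
    rw [h0] at h
    simp [P, eval_prod, hM0.ne'] at h
  · let E : Finset (ℕ × ℕ) := (Finset.range s ×ˢ Finset.range M).erase (0, 0)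
    have hE : E.card = s * M - 1 := by
      rw [Finset.card_erase_of_mem (by simp [hs0, hM0]), Finset.card_product, Finset.card_range,
        Finset.card_range]
    -- For fixed k = p.1 these are the M solutions of w^M = a^k. The pair (0, 0) left out of `E` is
    -- w = 1, where w/(w-1) has no meaning.
    let w : ℕ × ℕ → F := fun p => α ^ (p.1 + (q - 1) * p.2)
    have hwlt : ∀ p ∈ Finset.range s ×ˢ Finset.range M, p.1 + (q - 1) * p.2 < n := by
      intro p hp
      rw [Finset.mem_product, Finset.mem_range, Finset.mem_range] at hp
      calc p.1 + (q - 1) * p.2 < (q - 1) * (p.2 + 1) := by rw [mul_add]; omega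
        _ ≤ (q - 1) * M := Nat.mul_le_mul_left _ hp.2
        _ = n := hn
    have hwinj : Set.InjOn w (Finset.range s ×ˢ Finset.range M : Finset (ℕ × ℕ)) := by
      intro a ha b hb hab
      have h := hα.pow_inj (hwlt a ha) (hwlt b hb) hab
      simp only [Finset.mem_coe, Finset.mem_product, Finset.mem_range] at ha hb
      have h1 : a.1 = b.1 := by
        have := congrArg (· % (q - 1)) h
        simpa [Nat.add_mul_mod_self_left, Nat.mod_eq_of_lt (show a.1 < q - 1 by omega),
          Nat.mod_eq_of_lt (show b.1 < q - 1 by omega)] using this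
      have h2 : a.2 = b.2 :=
        Nat.eq_of_mul_eq_mul_left (show 0 < q - 1 by omega) (by omega)
      exact Prod.ext h1 h2
    have hw1 : ∀ p ∈ E, w p - 1 ≠ 0 := by
      intro p hp h
      have hp' := Finset.mem_erase.1 hp
      refine hp'.1 (hwinj hp'.2 (by simp [hs0, hM0]) ?_)
      simpa [w, sub_eq_zero] using h
    -- On `E` the point w/(w-1) is nonzero, hence a power of α; off `E` the index is arbitrary.
    have hex : ∀ p : ℕ × ℕ, ∃ j : Fin n, p ∈ E → α ^ (j : ℕ) = w p / (w p - 1) := by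
      intro p
      by_cases hp : p ∈ E
      · have : NeZero n := ⟨hn0.ne'⟩
        have := Fintype.ofFinite F
        have hx : (w p / (w p - 1)) ^ n = 1 := by
          rw [hndef, ← hF, Nat.card_eq_fintype_card]
          exact FiniteField.pow_card_sub_one_eq_one _
            (div_ne_zero (pow_ne_zero _ hα0) (hw1 p hp))
        obtain ⟨j, hj, h⟩ := hα.eq_pow_of_pow_eq_one hx
        exact ⟨⟨j, hj⟩, fun _ => h⟩
      · exact ⟨⟨0, hn0⟩, fun h => absurd h hp⟩
    choose f hf using hex
    have hzeros : E.card ≤ (Finset.univ.filter fun j => c j = 0).card := by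
      refine Finset.card_le_card_of_injOn f ?_ ?_
      · intro p hp
        have hp' := Finset.mem_product.1 (Finset.mem_erase.1 hp).2
        simp only [Finset.coe_filter, Finset.mem_univ, true_and, Set.mem_ofPred_eq]
        apply (algebraMap K F).injective
        rw [hc, hf p hp, map_zero, eval_prod]
        refine Finset.prod_eq_zero hp'.1 ?_
        -- With x = w/(w-1), x - 1 = 1/(w-1), so x^M = w^M (x-1)^M and the factor k = p.1 vanishes.
        have h1 : w p / (w p - 1) - 1 = 1 / (w p - 1) := by
          have := hw1 p hp
          field_simp
          ring
        have h2 : w p ^ M = (α ^ M) ^ p.1 := by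
          simp only [w]
          rw [← pow_mul, add_mul, mul_right_comm, hn, pow_add, pow_mul α n, hα.pow_eq_one,
            one_pow, mul_one, ← pow_mul, mul_comm]
        simp only [eval_sub, eval_pow, eval_X, eval_mul, eval_C]
        rw [h1, div_pow, div_pow, h2, one_pow, mul_one_div, sub_self]
      · intro a ha b hb hab
        have h := (hf a ha).symm.trans ((congrArg (fun j : Fin n => α ^ (j : ℕ)) hab).trans
          (hf b hb))
        have h1 := hw1 a ha
        have h2 := hw1 b hb
        rw [div_eq_div_iff h1 h2] at h
        exact hwinj (Finset.mem_erase.1 ha).2 (Finset.mem_erase.1 hb).2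
          (by linear_combination -h)
    have htot : (Finset.univ.filter fun j => c j = 0).card + hammingNorm c = n := by
      simpa [hammingNorm] using
        Finset.card_filter_add_card_filter_not (s := Finset.univ) (fun j => c j = 0)
    omega

end PrimitiveBCH

/-- Here `K` is the field with `q` elements and `F` its extension field with `q ^ m` elements;
the quotient `(q ^ m - 1) / (q - 1)` is exact. -/
theorem theorem5p5 {K F : Type*} [Field K] [Finite K] [DecidableEq K]
    [Field F] [Finite F] [Algebra K F]
    (q m r t : ℕ) (hq : Nat.card K = q) (hm : Module.finrank K F = m)
    (hr : r ∣ q - 1) (hr1 : 1 ≤ r) (hrq : r < q - 1)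
    (ht : t = r * ((q ^ m - 1) / (q - 1)))
    (α : F) (hα : IsPrimitiveRoot α (q ^ m - 1)) :
    HasMinDist (bchCode K (q ^ m - 1) α (t + 1) : Set (Fin (q ^ m - 1) → K)) (t + 1) ∧
      Module.finrank K (bchCode K (q ^ m - 1) α (t + 1)) = (q - r) ^ m - 1 := by
  have hcard : Nat.card F = q ^ m := by
    rw [Module.natCard_eq_pow_finrank (K := K), hq, hm]
  have hm0 : 0 < m := hm ▸ Module.finrank_pos
  obtain rfl : t = r * ∑ k ∈ Finset.range m, q ^ k := by
    rw [ht, Nat.geomSum_eq (by omega)]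
  refine ⟨⟨?_, ?_⟩, finrank_bchCode hq hcard hm0 hr1 (by omega) hα⟩
  · obtain ⟨c, hc, hc0, hle⟩ := exists_mem_bchCode_hammingNorm_le hq hcard hm0 hrq hα
    refine ⟨0, Submodule.zero_mem _, c, hc, hc0.symm, ?_⟩
    rw [hammingDist_zero_left]
    exact le_antisymm hle (le_hammingNorm_of_mem_bchCode hα hc hc0)
  · rintro _ ⟨x, hx, y, hy, hxy, rfl⟩
    rw [hammingDist_eq_hammingNorm]
    refine le_hammingNorm_of_mem_bchCode hα (Submodule.add_mem _ (Submodule.neg_mem _ hx) hy) ?_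
    rwa [Ne, neg_add_eq_zero]
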